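/- Let $T>0$ and let $\Omega\subset\mathbb{R}^2$ be bounded, convex and open. Let $H^3_0(\Omega)^2$ be the closure of $C_c^\infty(\Omega;\mathbb{R}^2)$ in $H^3(\Omega)^2$, let $H^{3,\mathrm{div}}_0(\Omega)^2:=\{f\in H^3_0(\Omega)^2 \mid \mathrm{div}\,f=0\}$ with the norm of $H^3(\Omega)^2$, and let $b\in L^2([0,T];H^{3,\mathrm{div}}_0(\Omega)^2)$ (Bochner space). For $x\in\Omega$, $b(t,x)$ denotes the value at $x$ of the continuous representative of $b(t)$. A classical flow of $b$ is a map $\Phi:[0,T]\times\Omega\to\Omega$ such that, for every $x\in\Omega$, $\Phi(0,x)=x$, the function $t\mapsto\Phi(t,x)$ is absolutely continuous on $[0,T]$, and $\partial_t\Phi(t,x)=b(t,\Phi(t,x))$ for almost every $t\in[0,T]$. Then $b$ has exactly one classical flow $\Phi$, and for every $t\in[0,T]$ the map $\Phi(t,\cdot):\Omega\to\Omega$ is Lipschitz continuous and a $C^1$ diffeomorphism of $\Omega$ onto itself (bijective, with $\Phi(t,\cdot)$ and its inverse both of class $C^1$ on $\Omega$). -/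

import Mathlib

open MeasureTheory Set
open scoped ENNReal NNReal ContDiff

noncomputable section

namespace ClassicalFlow

/-- The Euclidean plane. -/
abbrev Plane : Type := EuclideanSpace ℝ (Fin 2)

/-- Multi-indices `α = (α₁, α₂)` of order `|α| ≤ 3`. -/
abbrev MultiIndex : Type := {α : Fin 4 × Fin 4 // (α.1 : ℕ) + (α.2 : ℕ) ≤ 3}

/-- The order `|α| = α₁ + α₂`. -/
def MultiIndex.order (α : MultiIndex) : ℕ := (α.1.1 : ℕ) + (α.1.2 : ℕ)

/-- The multi-index `(0, 0)`. -/
def idx00 : MultiIndex := ⟨(0, 0), by decide⟩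

/-- The multi-index `(1, 0)`. -/
def idx10 : MultiIndex := ⟨(1, 0), by decide⟩

/-- The multi-index `(0, 1)`. -/
def idx01 : MultiIndex := ⟨(0, 1), by decide⟩

section Derivatives

variable {F : Type*} [NormedAddCommGroup F] [NormedSpace ℝ F]

/-- The classical partial derivative `∂ᵢ φ`. -/
def pderiv (i : Fin 2) (φ : Plane → F) : Plane → F :=
  fun x => fderiv ℝ φ x (EuclideanSpace.single i 1)

/-- The classical partial derivative `∂^α φ = ∂₁^{α₁} ∂₂^{α₂} φ`. -/
def mderiv (α : MultiIndex) (φ : Plane → F) : Plane → F :=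
  (pderiv 0)^[(α.1.1 : ℕ)] ((pderiv 1)^[(α.1.2 : ℕ)] φ)

/-- `φ ∈ C_c^∞(Ω; F)`, as a function on the whole plane. -/
structure IsTestFunction (Ω : Set Plane) (φ : Plane → F) : Prop where
  smooth : ContDiff ℝ ∞ φ
  compact : HasCompactSupport φ
  support : tsupport φ ⊆ Ω

theorem IsTestFunction.pderiv {Ω : Set Plane} {φ : Plane → F} (h : IsTestFunction Ω φ)
    (i : Fin 2) : IsTestFunction Ω (pderiv i φ) where
  smooth := (h.smooth.fderiv_right (m := ∞) le_rfl).clm_apply contDiff_const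
  compact := h.compact.fderiv_apply (𝕜 := ℝ) _
  support := (tsupport_fderiv_apply_subset ℝ _).trans h.support

theorem IsTestFunction.iter {Ω : Set Plane} {φ : Plane → F} (h : IsTestFunction Ω φ)
    (i : Fin 2) (n : ℕ) : IsTestFunction Ω ((ClassicalFlow.pderiv i)^[n] φ) := by
  induction n with
  | zero => exact h
  | succ n ih => rw [Function.iterate_succ_apply']; exact ih.pderiv i

theorem IsTestFunction.mderiv {Ω : Set Plane} {φ : Plane → F} (h : IsTestFunction Ω φ)
    (α : MultiIndex) : IsTestFunction Ω (mderiv α φ) := (h.iter 1 _).iter 0 _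

theorem IsTestFunction.zero (Ω : Set Plane) : IsTestFunction Ω (0 : Plane → F) where
  smooth := contDiff_const
  compact := HasCompactSupport.zero
  support := by simp [tsupport]

theorem IsTestFunction.add {Ω : Set Plane} {φ ψ : Plane → F} (h : IsTestFunction Ω φ)
    (k : IsTestFunction Ω ψ) : IsTestFunction Ω (φ + ψ) where
  smooth := h.smooth.add k.smooth
  compact := h.compact.add k.compact
  support := (tsupport_add φ ψ).trans (union_subset h.support k.support)

theorem IsTestFunction.const_smul {Ω : Set Plane} {φ : Plane → F} (h : IsTestFunction Ω φ)
    (c : ℝ) : IsTestFunction Ω (c • φ) where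
  smooth := h.smooth.const_smul c
  compact := h.compact.mono (Function.support_const_smul_subset c φ)
  support := (closure_mono (Function.support_const_smul_subset c φ)).trans h.support

theorem iter_add {Ω : Set Plane} {φ ψ : Plane → F} (h : IsTestFunction Ω φ)
    (k : IsTestFunction Ω ψ) (i : Fin 2) (n : ℕ) :
    (pderiv i)^[n] (φ + ψ) = (pderiv i)^[n] φ + (pderiv i)^[n] ψ := by
  induction n with
  | zero => rfl
  | succ n ih =>
    simp only [Function.iterate_succ_apply', ih]
    funext x
    have h1 := ((h.iter i n).smooth.differentiable (by simp)) x
    have h2 := ((k.iter i n).smooth.differentiable (by simp)) x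
    simp [pderiv, fderiv_add h1 h2]

theorem iter_const_smul {Ω : Set Plane} {φ : Plane → F} (h : IsTestFunction Ω φ) (c : ℝ)
    (i : Fin 2) (n : ℕ) : (pderiv i)^[n] (c • φ) = c • (pderiv i)^[n] φ := by
  induction n with
  | zero => rfl
  | succ n ih =>
    simp only [Function.iterate_succ_apply', ih]
    funext x
    have h1 := ((h.iter i n).smooth.differentiable (by simp)) x
    simp [pderiv, fderiv_const_smul h1 c]

theorem iter_zero (i : Fin 2) (n : ℕ) : (pderiv i)^[n] (0 : Plane → F) = 0 := by
  have := iter_const_smul (IsTestFunction.zero (F := F) univ) 0 i n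
  simpa using this

theorem mderiv_add {Ω : Set Plane} {φ ψ : Plane → F} (h : IsTestFunction Ω φ)
    (k : IsTestFunction Ω ψ) (α : MultiIndex) : mderiv α (φ + ψ) = mderiv α φ + mderiv α ψ := by
  rw [mderiv, iter_add h k, iter_add (h.iter 1 _) (k.iter 1 _)]; rfl

theorem mderiv_const_smul {Ω : Set Plane} {φ : Plane → F} (h : IsTestFunction Ω φ) (c : ℝ)
    (α : MultiIndex) : mderiv α (c • φ) = c • mderiv α φ := by
  rw [mderiv, iter_const_smul h, iter_const_smul (h.iter 1 _)]; rfl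

theorem mderiv_zero (α : MultiIndex) : mderiv α (0 : Plane → F) = 0 := by
  rw [mderiv, iter_zero, iter_zero]

end Derivatives

/-- `L²(Ω; ℝ²)` with Lebesgue measure. -/
abbrev L2 (Ω : Set Plane) : Type := Lp Plane 2 (volume.restrict Ω)

/-- Families `(f_α)_{|α| ≤ 3}` in `L²(Ω; ℝ²)`, normed by `(∑_α ‖f_α‖²)^{1/2}`. The space
`H³(Ω)²` is realized below as the subspace of those families with `f_α = ∂^α f_0` weakly, so that
it carries the usual norm `(∑_{|α| ≤ 3} ‖∂^α f‖²_{L²})^{1/2}`. -/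
abbrev Jet (Ω : Set Plane) : Type := PiLp 2 (fun _ : MultiIndex => L2 Ω)

/-- `g` is the weak derivative `∂^α f` on `Ω`. -/
def IsWeakDeriv (Ω : Set Plane) (α : MultiIndex) (f g : L2 Ω) : Prop :=
  ∀ φ : Plane → ℝ, IsTestFunction Ω φ →
    ∫ x in Ω, mderiv α φ x • f x = (-1 : ℝ) ^ α.order • ∫ x in Ω, φ x • g x

theorem integrable_test_smul {Ω : Set Plane} {φ : Plane → ℝ} (h : IsTestFunction Ω φ)
    (f : L2 Ω) : Integrable (fun x => φ x • f x) (volume.restrict Ω) :=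
  memLp_one_iff_integrable.1 ((Lp.memLp f).smul (r := 1)
    ((h.smooth.continuous.memLp_of_hasCompactSupport (p := 2) h.compact).restrict Ω))

theorem integral_test_add {Ω : Set Plane} {φ : Plane → ℝ} (h : IsTestFunction Ω φ)
    (f g : L2 Ω) : ∫ x in Ω, φ x • (f + g : L2 Ω) x
      = (∫ x in Ω, φ x • f x) + ∫ x in Ω, φ x • g x := by
  rw [← integral_add (integrable_test_smul h f) (integrable_test_smul h g)]
  refine integral_congr_ae ?_
  filter_upwards [Lp.coeFn_add f g] with x hx
  rw [hx, Pi.add_apply, smul_add]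

theorem integral_test_smul {Ω : Set Plane} (φ : Plane → ℝ) (c : ℝ)
    (f : L2 Ω) : ∫ x in Ω, φ x • (c • f : L2 Ω) x = c • ∫ x in Ω, φ x • f x := by
  rw [← integral_smul]
  refine integral_congr_ae ?_
  filter_upwards [Lp.coeFn_smul c f] with x hx
  rw [hx, Pi.smul_apply, smul_comm]

/-- The Sobolev space `H³(Ω)²`. -/
def H3 (Ω : Set Plane) : Submodule ℝ (Jet Ω) where
  carrier := {J | ∀ α, IsWeakDeriv Ω α (J idx00) (J α)}
  zero_mem' := by
    intro α φ hφ
    have key : ∀ ψ : Plane → ℝ, ∫ x in Ω, ψ x • (0 : L2 Ω) x = 0 := fun ψ => by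
      simpa using integral_test_smul ψ 0 (0 : L2 Ω)
    simp only [PiLp.zero_apply, key, smul_zero]
  add_mem' := by
    intro J K hJ hK α φ hφ
    simp only [PiLp.add_apply]
    rw [integral_test_add (hφ.mderiv α), integral_test_add hφ, hJ α φ hφ, hK α φ hφ, smul_add]
  smul_mem' := by
    intro c J hJ α φ hφ
    simp only [PiLp.smul_apply]
    rw [integral_test_smul, integral_test_smul, hJ α φ hφ, smul_comm]

/-- The families `(∂^α φ)_{|α| ≤ 3}` with `φ ∈ C_c^∞(Ω; ℝ²)`. -/
def testJets (Ω : Set Plane) : Submodule ℝ (Jet Ω) where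
  carrier := {J | ∃ φ : Plane → Plane, IsTestFunction Ω φ ∧
    ∀ α, (J α : Plane → Plane) =ᵐ[volume.restrict Ω] mderiv α φ}
  zero_mem' := ⟨0, IsTestFunction.zero Ω, fun α => by
    rw [mderiv_zero, PiLp.zero_apply]; exact Lp.coeFn_zero _ _ _⟩
  add_mem' := by
    rintro J K ⟨φ, hφ, hJ⟩ ⟨ψ, hψ, hK⟩
    refine ⟨φ + ψ, hφ.add hψ, fun α => ?_⟩
    rw [mderiv_add hφ hψ, PiLp.add_apply]
    exact (Lp.coeFn_add _ _).trans ((hJ α).add (hK α))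
  smul_mem' := by
    rintro c J ⟨φ, hφ, hJ⟩
    refine ⟨c • φ, hφ.const_smul c, fun α => ?_⟩
    rw [mderiv_const_smul hφ, PiLp.smul_apply]
    exact (Lp.coeFn_smul _ _).trans ((hJ α).const_smul c)

/-- `H³₀(Ω)²`: the closure of `C_c^∞(Ω; ℝ²)` in `H³(Ω)²`. -/
def H30 (Ω : Set Plane) : Submodule ℝ (Jet Ω) := H3 Ω ⊓ (testJets Ω).topologicalClosure

/-- The families whose underlying vector field is divergence free: `∂₁ f₁ + ∂₂ f₂ = 0` a.e. -/
def divFree (Ω : Set Plane) : Submodule ℝ (Jet Ω) where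
  carrier := {J | ∀ᵐ x ∂(volume.restrict Ω), J idx10 x 0 + J idx01 x 1 = 0}
  zero_mem' := by
    change ∀ᵐ x ∂(volume.restrict Ω), (0 : L2 Ω) x 0 + (0 : L2 Ω) x 1 = 0
    filter_upwards [Lp.coeFn_zero Plane 2 (volume.restrict Ω)] with x hx
    rw [hx]
    simp
  add_mem' := by
    intro J K hJ hK
    simp only [mem_ofPred_eq, PiLp.add_apply] at hJ hK ⊢
    filter_upwards [hJ, hK, Lp.coeFn_add (J idx10) (K idx10),
      Lp.coeFn_add (J idx01) (K idx01)] with x h1 h2 h3 h4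
    simp only [h3, h4, Pi.add_apply, PiLp.add_apply]
    linarith
  smul_mem' := by
    intro c J hJ
    simp only [mem_ofPred_eq, PiLp.smul_apply] at hJ ⊢
    filter_upwards [hJ, Lp.coeFn_smul c (J idx10), Lp.coeFn_smul c (J idx01)] with x h1 h2 h3
    simp only [h2, h3, Pi.smul_apply, PiLp.smul_apply, smul_eq_mul]
    rw [← mul_add, h1, mul_zero]

/-- `H^{3,div}_0(Ω)² = {f ∈ H³₀(Ω)² | div f = 0}`, with the norm of `H³(Ω)²`. -/
def H30div (Ω : Set Plane) : Submodule ℝ (Jet Ω) := H30 Ω ⊓ divFree Ω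

/-- The Bochner space `L²([0,T]; H^{3,div}_0(Ω)²)`. -/
abbrev FlowField (T : ℝ) (Ω : Set Plane) : Type :=
  Lp (H30div Ω) 2 (volume.restrict (Icc (0 : ℝ) T))

open Classical in
/-- The continuous representative on `Ω` of the class of `f`, if there is one (for open `Ω` its
values on `Ω` are then determined by `f`); `f` itself otherwise. -/
def contRep (Ω : Set Plane) (f : Plane → Plane) : Plane → Plane :=
  if h : ∃ g : Plane → Plane, ContinuousOn g Ω ∧ g =ᵐ[volume.restrict Ω] f then h.choose else f

/-- The value `b(t, x)` of a flow field, through the continuous representative of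
`b(t) ∈ H³₀(Ω)²`. -/
def FlowField.eval {T : ℝ} {Ω : Set Plane} (b : FlowField T Ω) (t : ℝ) : Plane → Plane :=
  contRep Ω ((b t : Jet Ω) idx00)

/-- `Φ : [0,T] × Ω → Ω` is a classical flow of `b`: `∂ₜΦ(t,x) = b(t,Φ(t,x))`, `Φ(0,x) = x`.
As `b` is only square integrable in time, solutions are understood in the sense of Carathéodory:
absolutely continuous in time, with the equation holding for almost every `t`. -/
structure IsClassicalFlow {T : ℝ} {Ω : Set Plane} (b : FlowField T Ω)
    (Φ : ℝ → Plane → Plane) : Prop where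
  mapsTo : ∀ t ∈ Icc 0 T, MapsTo (Φ t) Ω Ω
  initial : ∀ x ∈ Ω, Φ 0 x = x
  absCont : ∀ x ∈ Ω, AbsolutelyContinuousOnInterval (fun t => Φ t x) 0 T
  ode : ∀ x ∈ Ω, ∀ᵐ t ∂(volume.restrict (Icc 0 T)),
    HasDerivAt (fun s => Φ s x) (b.eval t (Φ t x)) t

/-- `f` restricts to a `C¹` diffeomorphism of `Ω` onto itself. -/
def IsC1DiffeoOn (Ω : Set Plane) (f : Plane → Plane) : Prop :=
  BijOn f Ω Ω ∧ ContDiffOn ℝ 1 f Ω ∧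
    ∃ g : Plane → Plane, MapsTo g Ω Ω ∧ InvOn g f Ω Ω ∧ ContDiffOn ℝ 1 g Ω

end ClassicalFlow

end

/-!
The field `b(t)` lies in `H³₀(Ω)²`, and in the plane `H³₀(Ω)` embeds into the bounded `C¹` functions
on the whole plane that vanish outside `Ω`. For a test function this is elementary: integrating
along the two axes gives `sup |φ| ≤ ∫ |∂₁∂₂φ|` (`enorm_le_lintegral_mixed`), and by the
Cauchy-Schwarz inequality on the bounded set `Ω` the right side is at most a constant times an `L²`
norm; applied to `φ`, `∂₁φ` and `∂₂φ` this uses derivatives of order at most three. The general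
case follows by taking the closure of the graph of `φ ↦ (φ, Dφ)` (`jetGraph`, `c1Ext`). Hence `b`
extends to a field on the plane which is `C¹` in space, with `C¹` norm integrable in time
(`extField`).

The flow of such a Carathéodory field exists on any Banach space and is `C¹` in the initial value.
For a base time `t₀`, the map `u ↦ ∫_{t₀}^t b(s, u(s)) ds` becomes a contraction `N` with constant
`1/2` on the bounded continuous curves once curves are multiplied by a sufficiently steep weight
`exp (-lam |t - t₀|)` (`C1Field.norm_picard_sub_le`), and `N` is continuously differentiable by
dominated convergence (`C1Field.contDiff_picard`). So `id - N` is a homeomorphism with Lipschitz and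
`C¹` inverse, and applying this inverse to weighted constant curves yields the flow. It is the only
solution of the integral equation (`C1Field.eq_flow`), which gives the group property: the flow
from `0` to `t` has as its inverse the flow from `t` to `0`. Points outside `Ω` are at rest, so `Ω`
is mapped onto itself.

Finally, the trajectories of a classical flow are absolutely continuous and differentiable almost
everywhere with the prescribed derivative, so they satisfy the integral equation of the extended
field (`IsClassicalFlow.eqOn_flow`).
-/

noncomputable section

namespace ClassicalFlow

open Filter Topology BoundedContinuousFunction

/-! ### Integrable `C¹` fields and exponential weights -/

/-- Bounded continuous maps into a normed group, with the metric of the target taken from its norm.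
For `F` a space of continuous linear maps, `E →ᵇ F` would take the metric from another instance,
under which instance search does not find the sup norm compatible with the topology. -/
abbrev BddMap (E F : Type*) [TopologicalSpace E] [NormedAddCommGroup F] : Type _ := E →ᵇ F

/-- A Carathéodory vector field on a normed space: `val t` is a bounded `C¹` field with bounded
derivative `der t`, and both depend integrably on the time `t ∈ ℝ` in the sense of Bochner,
for the sup norms. -/
structure C1Field (E : Type*) [NormedAddCommGroup E] [NormedSpace ℝ E] where
  /-- The field at time `t`. -/
  val : ℝ → E →ᵇ E
  /-- The spatial derivative of the field at time `t`. -/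
  der : ℝ → BddMap E (E →L[ℝ] E)
  hasFDerivAt : ∀ t x, HasFDerivAt (val t) (der t x) x
  integrable_val : Integrable val
  integrable_der : Integrable der

theorem integrable_exp_neg_mul_abs_sub {lam : ℝ} (hl : 0 < lam) (t : ℝ) :
    Integrable (fun s => Real.exp (-(lam * |t - s|))) ∧
      ∫ s, Real.exp (-(lam * |t - s|)) = 2 / lam := by
  have h : ∫ s, Real.exp (-(lam * |t - s|)) = 2 / lam := by
    rw [integral_sub_left_eq_self (fun s => Real.exp (-(lam * |s|))) volume t]
    have h1 := Measure.integral_comp_mul_left (fun x => Real.exp (-|x|)) lam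
    simp only [abs_mul, abs_of_pos hl] at h1
    rw [h1, integral_comp_abs (f := fun x => Real.exp (-x)), integral_exp_neg_Ioi]
    simp [abs_of_pos (inv_pos.2 hl)]
    ring
  refine ⟨?_, h⟩
  -- The integral of a non-integrable function is `0` by convention.
  by_contra hn
  rw [integral_undef hn] at h
  have : 0 < 2 / lam := by positivity
  linarith

/-- An integrable function is small when averaged against a sufficiently steep exponential
weight, uniformly in the base point. -/
theorem exists_exp_weight {L : ℝ → ℝ} (hL : Integrable L) :
    ∃ lam > 0, ∀ t, ∫ s, |L s| * Real.exp (-(lam * |t - s|)) ≤ 1 / 2 := by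
  obtain ⟨g, hg, hgi⟩ := hL.exists_boundedContinuous_integral_sub_le (ε := 1 / 4) (by norm_num)
  -- The bounded approximation `g` contributes `‖g‖ * (2 / lam) ≤ 1 / 4`, the remainder `1 / 4`.
  refine ⟨8 * ‖g‖ + 1, by positivity, fun t => ?_⟩
  have hlp : 0 < 8 * ‖g‖ + 1 := by positivity
  obtain ⟨hi, hv⟩ := integrable_exp_neg_mul_abs_sub hlp t
  calc ∫ s, |L s| * Real.exp (-((8 * ‖g‖ + 1) * |t - s|))
      ≤ ∫ s, (‖L s - g s‖ + ‖g‖ * Real.exp (-((8 * ‖g‖ + 1) * |t - s|))) := by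
        refine integral_mono_of_nonneg (Eventually.of_forall fun s => by positivity)
          ((hL.sub hgi).norm.add (hi.const_mul _)) (Eventually.of_forall fun s => ?_)
        have h1 : |L s| ≤ ‖L s - g s‖ + ‖g‖ := by
          have := norm_add_le (L s - g s) (g s)
          rw [sub_add_cancel] at this
          exact this.trans (by gcongr; exact g.norm_coe_le_norm s)
        have h2 : Real.exp (-((8 * ‖g‖ + 1) * |t - s|)) ≤ 1 :=
          Real.exp_le_one_iff.2 (neg_nonpos.2 (by positivity))
        have h3 := Real.exp_pos (-((8 * ‖g‖ + 1) * |t - s|))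
        nlinarith [norm_nonneg (L s - g s), norm_nonneg g,
          mul_le_mul_of_nonneg_right h1 h3.le,
          mul_le_mul_of_nonneg_left h2 (norm_nonneg (L s - g s))]
    _ = (∫ s, ‖L s - g s‖) + ‖g‖ * (2 / (8 * ‖g‖ + 1)) := by
        rw [← hv, ← integral_const_mul]
        exact integral_add (hL.sub hgi).norm (hi.const_mul _)
    _ ≤ 1 / 4 + 1 / 4 := by
        refine add_le_add hg ?_
        rw [mul_div_assoc', div_le_div_iff₀ hlp (by norm_num)]
        linarith
    _ = 1 / 2 := by norm_num

/-- Along the interval between the base point `t₀` and `t`, the quotient of the weights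
`exp (-lam |· - t₀|)` at `t` and at `s` only depends on `|t - s|`. -/
theorem exp_weight_mul {lam t₀ t s : ℝ} (hs : s ∈ uIoc t₀ t) :
    Real.exp (-(lam * |t - t₀|)) * Real.exp (lam * |s - t₀|)
      = Real.exp (-(lam * |t - s|)) := by
  rw [← Real.exp_add]
  congr 1
  rcases le_total t₀ t with h | h
  · rw [uIoc_of_le h] at hs
    rw [abs_of_nonneg (by linarith : 0 ≤ t - t₀), abs_of_nonneg (by linarith [hs.1] : 0 ≤ s - t₀),
      abs_of_nonneg (by linarith [hs.2] : 0 ≤ t - s)]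
    ring
  · rw [uIoc_of_ge h] at hs
    rw [abs_of_nonpos (by linarith : t - t₀ ≤ 0), abs_of_nonpos (by linarith [hs.2] : s - t₀ ≤ 0),
      abs_of_nonpos (by linarith [hs.1] : t - s ≤ 0)]
    ring

namespace C1Field

variable {E : Type*} [NormedAddCommGroup E] [NormedSpace ℝ E] (B : C1Field E)

theorem norm_val_sub_le (s : ℝ) (x y : E) :
    ‖B.val s x - B.val s y‖ ≤ ‖B.der s‖ * ‖x - y‖ :=
  Convex.norm_image_sub_le_of_norm_hasFDerivWithin_le
    (fun z _ => (B.hasFDerivAt s z).hasFDerivWithinAt)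
    (fun z _ => (B.der s).norm_coe_le_norm z) convex_univ (mem_univ y) (mem_univ x)

theorem integrable_val_comp {u : ℝ → E} (hu : Continuous u) :
    Integrable (fun s => B.val s (u s)) :=
  B.integrable_val.norm.mono'
    (continuous_eval.comp_aestronglyMeasurable
      (B.integrable_val.aestronglyMeasurable.prodMk hu.aestronglyMeasurable))
    (Eventually.of_forall fun s => (B.val s).norm_coe_le_norm _)

theorem integrable_der_comp {u : ℝ → E} (hu : Continuous u) :
    Integrable (fun s => B.der s (u s)) :=
  B.integrable_der.norm.mono'
    (continuous_eval.comp_aestronglyMeasurable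
      (B.integrable_der.aestronglyMeasurable.prodMk hu.aestronglyMeasurable))
    (Eventually.of_forall fun s => (B.der s).norm_coe_le_norm _)

/-- The steepness of an exponential weight in time for which the Picard operator of the field is a
contraction with constant `1/2`, whatever the base point. -/
def steepness : ℝ := (exists_exp_weight B.integrable_der.norm).choose

theorem steepness_pos : 0 < B.steepness :=
  (exists_exp_weight B.integrable_der.norm).choose_spec.1

/-- The weight `exp (-lam |t - t₀|)`. -/
def weight (t₀ t : ℝ) : ℝ := Real.exp (-(B.steepness * |t - t₀|))

/-- The inverse `exp (lam |t - t₀|)` of the weight. -/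
def weightInv (t₀ t : ℝ) : ℝ := Real.exp (B.steepness * |t - t₀|)

theorem weight_mul_weightInv (t₀ t : ℝ) : B.weight t₀ t * B.weightInv t₀ t = 1 := by
  rw [weight, weightInv, ← Real.exp_add, neg_add_cancel, Real.exp_zero]

theorem weightInv_mul_weight (t₀ t : ℝ) : B.weightInv t₀ t * B.weight t₀ t = 1 := by
  rw [mul_comm, weight_mul_weightInv]

theorem weight_pos (t₀ t : ℝ) : 0 < B.weight t₀ t := Real.exp_pos _

theorem weightInv_pos (t₀ t : ℝ) : 0 < B.weightInv t₀ t := Real.exp_pos _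

theorem weight_le_one (t₀ t : ℝ) : B.weight t₀ t ≤ 1 :=
  Real.exp_le_one_iff.2 (neg_nonpos.2 (mul_nonneg B.steepness_pos.le (abs_nonneg _)))

theorem continuous_weight (t₀ : ℝ) : Continuous (B.weight t₀) := by
  unfold weight; fun_prop

theorem continuous_weightInv (t₀ : ℝ) : Continuous (B.weightInv t₀) := by
  unfold weightInv; fun_prop

theorem weight_mul_weightInv_le_one {t₀ t s : ℝ} (hs : s ∈ uIoc t₀ t) :
    B.weight t₀ t * B.weightInv t₀ s ≤ 1 := by
  rw [weight, weightInv, exp_weight_mul hs]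
  exact Real.exp_le_one_iff.2 (neg_nonpos.2 (mul_nonneg B.steepness_pos.le (abs_nonneg _)))

/-- The estimate behind the contraction property: a function bounded by `C ‖der s‖ / weight s` has
a weighted primitive bounded by `C / 2`. -/
theorem norm_weight_smul_integral_le {t₀ t C : ℝ} (hC : 0 ≤ C) {f : ℝ → E}
    (hf : ∀ s, ‖f s‖ ≤ ‖B.der s‖ * (B.weightInv t₀ s * C)) :
    ‖B.weight t₀ t • ∫ s in t₀..t, f s‖ ≤ 1 / 2 * C := by
  have hint : Integrable fun s => |‖B.der s‖| * Real.exp (-(B.steepness * |t - s|)) := by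
    refine B.integrable_der.norm.abs.mul_bdd (c := 1) (by fun_prop)
      (Eventually.of_forall fun s => ?_)
    rw [Real.norm_of_nonneg (Real.exp_pos _).le]
    exact Real.exp_le_one_iff.2 (neg_nonpos.2 (mul_nonneg B.steepness_pos.le (abs_nonneg _)))
  rw [← intervalIntegral.integral_smul]
  calc ‖∫ s in t₀..t, B.weight t₀ t • f s‖
      ≤ ∫ s in uIoc t₀ t, ‖B.weight t₀ t • f s‖ :=
        intervalIntegral.norm_integral_le_integral_norm_uIoc
    _ ≤ ∫ s in uIoc t₀ t, (|‖B.der s‖| * Real.exp (-(B.steepness * |t - s|))) * C := by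
        refine integral_mono_of_nonneg (Eventually.of_forall fun s => norm_nonneg _)
          (hint.mul_const C).integrableOn ?_
        filter_upwards [ae_restrict_mem measurableSet_uIoc] with s hs
        rw [norm_smul, Real.norm_of_nonneg (B.weight_pos _ _).le, ← exp_weight_mul hs, abs_norm]
        calc B.weight t₀ t * ‖f s‖
            ≤ B.weight t₀ t * (‖B.der s‖ * (B.weightInv t₀ s * C)) := by
              gcongr
              · exact (B.weight_pos _ _).le
              · exact hf s
          _ = _ := by rw [weight, weightInv]; ring
    _ ≤ ∫ s, (|‖B.der s‖| * Real.exp (-(B.steepness * |t - s|))) * C :=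
        setIntegral_le_integral (hint.mul_const C)
          (Eventually.of_forall fun s => by positivity)
    _ ≤ 1 / 2 * C := by
        rw [integral_mul_const]
        gcongr
        exact (exists_exp_weight B.integrable_der.norm).choose_spec.2 t

/-- Bounded continuous curves in `E`. -/
abbrev Curve (E : Type*) [NormedAddCommGroup E] : Type _ := ℝ →ᵇ E

/-- The curve `s ↦ w s / weight s` whose weighted version is `w`. -/
def unweight (t₀ : ℝ) (w : Curve E) (s : ℝ) : E := B.weightInv t₀ s • w s

theorem continuous_unweight (t₀ : ℝ) (w : Curve E) : Continuous (B.unweight t₀ w) :=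
  (B.continuous_weightInv t₀).smul w.continuous

theorem intervalIntegrable_der_unweight (t₀ : ℝ) (w v : Curve E) (a c : ℝ) :
    IntervalIntegrable (fun s => B.der s (B.unweight t₀ w s) (B.unweight t₀ v s)) volume a c := by
  have h1 : Integrable fun s => B.der s (B.unweight t₀ w s) (v s) := by
    refine (B.integrable_der.norm.mul_const ‖v‖).mono' ?_ (Eventually.of_forall fun s => ?_)
    · exact (ContinuousLinearMap.apply ℝ E).flip.aestronglyMeasurable_comp₂
        (B.integrable_der_comp (B.continuous_unweight t₀ w)).aestronglyMeasurable
        v.continuous.aestronglyMeasurable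
    · exact ((B.der s _).le_opNorm _).trans (mul_le_mul ((B.der s).norm_coe_le_norm _)
        (v.norm_coe_le_norm s) (norm_nonneg _) (norm_nonneg _))
  have h2 := (h1.intervalIntegrable (a := a) (b := c)).continuousOn_smul
    (B.continuous_weightInv t₀).continuousOn
  simpa only [unweight, map_smul] using h2

/-! ### The weighted Picard operator -/

/-- The Picard operator with base time `t₀`, conjugated by the exponential weight: for
`w = weight • u` it is `weight • ∫_{t₀}^t b(s, u(s)) ds`. -/
def picard (t₀ : ℝ) (w : Curve E) : Curve E :=
  ofNormedAddCommGroup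
    (fun t => B.weight t₀ t • ∫ s in t₀..t, B.val s (B.unweight t₀ w s))
    ((B.continuous_weight t₀).smul
      ((B.integrable_val_comp (B.continuous_unweight t₀ w)).continuous_primitive t₀))
    (∫ s, ‖B.val s‖)
    (fun t => by
      rw [norm_smul, Real.norm_of_nonneg (B.weight_pos _ _).le]
      refine (mul_le_of_le_one_left (norm_nonneg _) (B.weight_le_one _ _)).trans ?_
      refine intervalIntegral.norm_integral_le_integral_norm_uIoc.trans ?_
      have hi := (B.integrable_val_comp (B.continuous_unweight t₀ w)).norm
      refine (setIntegral_le_integral hi (Eventually.of_forall fun s => norm_nonneg _)).trans ?_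
      exact integral_mono hi B.integrable_val.norm fun s => (B.val s).norm_coe_le_norm _)

theorem picard_apply (t₀ : ℝ) (w : Curve E) (t : ℝ) :
    B.picard t₀ w t = B.weight t₀ t • ∫ s in t₀..t, B.val s (B.unweight t₀ w s) := rfl

theorem norm_unweight_le (t₀ : ℝ) (w : Curve E) (s : ℝ) :
    ‖B.unweight t₀ w s‖ ≤ B.weightInv t₀ s * ‖w‖ := by
  rw [unweight, norm_smul, Real.norm_of_nonneg (B.weightInv_pos _ _).le]
  exact mul_le_mul_of_nonneg_left (w.norm_coe_le_norm s) (B.weightInv_pos _ _).le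

theorem unweight_sub (t₀ : ℝ) (w w' : Curve E) (s : ℝ) :
    B.unweight t₀ (w - w') s = B.unweight t₀ w s - B.unweight t₀ w' s := by
  simp only [unweight, BoundedContinuousFunction.sub_apply, smul_sub]

theorem norm_picard_sub_le (t₀ : ℝ) (w w' : Curve E) :
    ‖B.picard t₀ w - B.picard t₀ w'‖ ≤ 1 / 2 * ‖w - w'‖ := by
  refine (norm_le (by positivity)).2 fun t => ?_
  rw [BoundedContinuousFunction.sub_apply, picard_apply, picard_apply, ← smul_sub, ←
    intervalIntegral.integral_sub
      (B.integrable_val_comp (B.continuous_unweight t₀ w)).intervalIntegrable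
      (B.integrable_val_comp (B.continuous_unweight t₀ w')).intervalIntegrable]
  refine B.norm_weight_smul_integral_le (norm_nonneg _) fun s => ?_
  refine (B.norm_val_sub_le s _ _).trans ?_
  rw [← unweight_sub]
  gcongr
  exact B.norm_unweight_le _ _ _

/-- The derivative `v ↦ weight • ∫_{t₀}^t Db(s, u(s)) (v(s) / weight(s)) ds` of the weighted Picard
operator at `w = weight • u`. -/
def picardDeriv (t₀ : ℝ) (w : Curve E) : Curve E →L[ℝ] Curve E :=
  have bound : ∀ (v : Curve E) (t : ℝ),
      ‖B.weight t₀ t • ∫ s in t₀..t, B.der s (B.unweight t₀ w s) (B.unweight t₀ v s)‖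
        ≤ 1 / 2 * ‖v‖ := fun v t =>
    B.norm_weight_smul_integral_le (norm_nonneg v) fun s =>
      ((B.der s _).le_opNorm _).trans (mul_le_mul ((B.der s).norm_coe_le_norm _)
        (B.norm_unweight_le _ _ _) (norm_nonneg _) (norm_nonneg _))
  LinearMap.mkContinuous
    { toFun := fun v => ofNormedAddCommGroup
        (fun t => B.weight t₀ t • ∫ s in t₀..t, B.der s (B.unweight t₀ w s) (B.unweight t₀ v s))
        ((B.continuous_weight t₀).smul (intervalIntegral.continuous_primitive
          (B.intervalIntegrable_der_unweight t₀ w v) t₀)) (1 / 2 * ‖v‖) (bound v)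
      map_add' := fun v v' => by
        ext t
        simp only [BoundedContinuousFunction.coe_ofNormedAddCommGroup,
          BoundedContinuousFunction.add_apply]
        rw [← smul_add, ← intervalIntegral.integral_add
          (B.intervalIntegrable_der_unweight t₀ w v _ _)
          (B.intervalIntegrable_der_unweight t₀ w v' _ _)]
        simp only [unweight, BoundedContinuousFunction.add_apply, smul_add, map_add]
      map_smul' := fun c v => by
        ext t
        simp only [BoundedContinuousFunction.coe_ofNormedAddCommGroup,
          BoundedContinuousFunction.smul_apply, RingHom.id_apply]
        have h : ∀ s, B.unweight t₀ (c • v) s = c • B.unweight t₀ v s := fun s => smul_comm _ _ _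
        simp only [h, map_smul, intervalIntegral.integral_smul]
        exact smul_comm _ _ _ }
    (1 / 2) fun v => (norm_le (by positivity)).2 (bound v)

theorem picardDeriv_apply (t₀ : ℝ) (w v : Curve E) (t : ℝ) :
    B.picardDeriv t₀ w v t
      = B.weight t₀ t • ∫ s in t₀..t, B.der s (B.unweight t₀ w s) (B.unweight t₀ v s) := rfl

theorem norm_picardDeriv_le (t₀ : ℝ) (w : Curve E) : ‖B.picardDeriv t₀ w‖ ≤ 1 / 2 :=
  by
  refine ContinuousLinearMap.opNorm_le_bound _ (by norm_num) fun v =>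
    (norm_le (by positivity)).2 fun t => ?_
  exact B.norm_weight_smul_integral_le (norm_nonneg v) fun s =>
    ((B.der s _).le_opNorm _).trans (mul_le_mul ((B.der s).norm_coe_le_norm _)
      (B.norm_unweight_le _ _ _) (norm_nonneg _) (norm_nonneg _))

theorem norm_picardDeriv_sub_le (t₀ : ℝ) (w w' : Curve E) :
    ‖B.picardDeriv t₀ w' - B.picardDeriv t₀ w‖
      ≤ ∫ s, ‖B.der s (B.unweight t₀ w' s) - B.der s (B.unweight t₀ w s)‖ := by
  have hint := ((B.integrable_der_comp (B.continuous_unweight t₀ w')).sub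
    (B.integrable_der_comp (B.continuous_unweight t₀ w))).norm
  refine ContinuousLinearMap.opNorm_le_bound _ (integral_nonneg fun s => norm_nonneg _)
    fun v => (norm_le (by positivity)).2 fun t => ?_
  rw [_root_.sub_apply, BoundedContinuousFunction.sub_apply, picardDeriv_apply,
    picardDeriv_apply, ← smul_sub, ← intervalIntegral.integral_sub
      (B.intervalIntegrable_der_unweight t₀ w' v _ _)
      (B.intervalIntegrable_der_unweight t₀ w v _ _), ← intervalIntegral.integral_smul]
  refine intervalIntegral.norm_integral_le_integral_norm_uIoc.trans ?_
  calc _ ≤ ∫ s in uIoc t₀ t,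
        ‖B.der s (B.unweight t₀ w' s) - B.der s (B.unweight t₀ w s)‖ * ‖v‖ := by
        refine integral_mono_of_nonneg (Eventually.of_forall fun s => norm_nonneg _)
          (hint.mul_const _).integrableOn ?_
        filter_upwards [ae_restrict_mem measurableSet_uIoc] with s hs
        rw [← _root_.sub_apply, show B.unweight t₀ v s = B.weightInv t₀ s • v s from rfl,
          map_smul, smul_smul, norm_smul,
          Real.norm_of_nonneg (mul_nonneg (B.weight_pos _ _).le (B.weightInv_pos _ _).le)]
        refine (mul_le_of_le_one_left (norm_nonneg _) (B.weight_mul_weightInv_le_one hs)).trans ?_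
        refine (ContinuousLinearMap.le_opNorm _ _).trans ?_
        gcongr
        exact v.norm_coe_le_norm s
    _ ≤ ∫ s, ‖B.der s (B.unweight t₀ w' s) - B.der s (B.unweight t₀ w s)‖ * ‖v‖ :=
        setIntegral_le_integral (hint.mul_const _) (Eventually.of_forall fun s => by positivity)
    _ = _ := integral_mul_const _ _

theorem continuous_picardDeriv (t₀ : ℝ) : Continuous (B.picardDeriv t₀) := by
  rw [continuous_iff_continuousAt]
  intro w
  rw [ContinuousAt, tendsto_iff_norm_sub_tendsto_zero]
  refine squeeze_zero (fun w' => norm_nonneg _) (fun w' => B.norm_picardDeriv_sub_le t₀ w w') ?_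
  have h : Tendsto (fun w' : Curve E =>
      ∫ s, ‖B.der s (B.unweight t₀ w' s) - B.der s (B.unweight t₀ w s)‖) (𝓝 w)
      (𝓝 (∫ _ : ℝ, (0 : ℝ))) := by
    refine tendsto_integral_filter_of_dominated_convergence (fun s => ‖B.der s‖ + ‖B.der s‖)
      (Eventually.of_forall fun w' =>
        ((B.integrable_der_comp (B.continuous_unweight t₀ w')).sub
          (B.integrable_der_comp (B.continuous_unweight t₀ w))).norm.aestronglyMeasurable)
      (Eventually.of_forall fun w' => Eventually.of_forall fun s => ?_)
      (B.integrable_der.norm.add B.integrable_der.norm) (Eventually.of_forall fun s => ?_)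
    · rw [norm_norm]
      exact (norm_sub_le _ _).trans
        (add_le_add ((B.der s).norm_coe_le_norm _) ((B.der s).norm_coe_le_norm _))
    · rw [← tendsto_iff_norm_sub_tendsto_zero]
      have hc : Continuous fun w' : Curve E => B.der s (B.unweight t₀ w' s) :=
        (B.der s).continuous.comp
          ((ContinuousEvalConst.continuous_eval_const s).const_smul (B.weightInv t₀ s))
      exact hc.tendsto w
  simpa using h

/-- Differentiation under the integral sign, at a fixed time and in a fixed direction. In this form
only the integrands have to be measurable; the evaluation `s ↦ (v ↦ v s)` is not norm continuous,
so a Fréchet derivative cannot be taken under the integral sign. -/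
theorem hasDerivAt_picard_line (t₀ : ℝ) (w v : Curve E) (t θ : ℝ) [CompleteSpace E] :
    HasDerivAt (fun r : ℝ => B.picard t₀ (w + r • v) t)
      (B.picardDeriv t₀ (w + θ • v) v t) θ := by
  simp only [picard_apply, picardDeriv_apply]
  refine HasDerivAt.const_smul _ ?_
  refine (intervalIntegral.hasDerivAt_integral_of_dominated_loc_of_deriv_le (s := univ)
    (F := fun r s => B.val s (B.unweight t₀ (w + r • v) s))
    (F' := fun r s => B.der s (B.unweight t₀ (w + r • v) s) (B.unweight t₀ v s))
    (bound := fun s => (B.weightInv t₀ s * ‖v‖) • ‖B.der s‖)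
    univ_mem ?_ ?_ ?_ ?_ ?_ ?_).2
  · exact Eventually.of_forall fun r =>
      (B.integrable_val_comp (B.continuous_unweight t₀ _)).aestronglyMeasurable.restrict
  · exact (B.integrable_val_comp (B.continuous_unweight t₀ _)).intervalIntegrable
  · exact (B.intervalIntegrable_der_unweight t₀ _ v _ _).aestronglyMeasurable_restrict_uIoc
  · refine Eventually.of_forall fun s _ r _ => ?_
    rw [smul_eq_mul, mul_comm]
    exact ((B.der s _).le_opNorm _).trans (mul_le_mul ((B.der s).norm_coe_le_norm _)
      (B.norm_unweight_le _ _ _) (norm_nonneg _) (norm_nonneg _))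
  · exact B.integrable_der.norm.intervalIntegrable.continuousOn_smul
      ((B.continuous_weightInv t₀).mul continuous_const).continuousOn
  · refine Eventually.of_forall fun s _ r _ => ?_
    refine (B.hasFDerivAt s _).comp_hasDerivAt r ?_
    have h1 : HasDerivAt (fun r : ℝ => w s + r • v s) (v s) r := by
      simpa using ((hasDerivAt_id r).smul_const (v s)).const_add (w s)
    exact h1.const_smul (B.weightInv t₀ s)

/-- The weighted Picard operator is Fréchet differentiable: it has directional derivatives at each
time, and these depend continuously on the curve in operator norm. -/
theorem hasFDerivAt_picard [CompleteSpace E] (t₀ : ℝ) (w : Curve E) :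
    HasFDerivAt (B.picard t₀) (B.picardDeriv t₀ w) w := by
  rw [hasFDerivAt_iff_isLittleO, Asymptotics.isLittleO_iff]
  intro ε hε
  obtain ⟨δ, hδ, hd⟩ := Metric.continuousAt_iff.1 (B.continuous_picardDeriv t₀).continuousAt ε hε
  filter_upwards [Metric.ball_mem_nhds w hδ] with w' hw'
  set v := w' - w with hv
  -- Mean value inequality along the segment from `w` to `w'`, uniformly in the time `t`.
  refine (norm_le (by positivity)).2 fun t => ?_
  have hder : ∀ θ ∈ Icc (0 : ℝ) 1, HasDerivWithinAt
      (fun r : ℝ => B.picard t₀ (w + r • v) t - r • B.picardDeriv t₀ w v t)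
      (B.picardDeriv t₀ (w + θ • v) v t - B.picardDeriv t₀ w v t) (Icc 0 1) θ := fun θ _ => by
    have h1 := (hasDerivAt_id θ).smul_const (B.picardDeriv t₀ w v t)
    rw [one_smul] at h1
    exact ((B.hasDerivAt_picard_line t₀ w v t θ).sub h1).hasDerivWithinAt
  have hbound : ∀ θ ∈ Ico (0 : ℝ) 1,
      ‖B.picardDeriv t₀ (w + θ • v) v t - B.picardDeriv t₀ w v t‖ ≤ ε * ‖v‖ := fun θ hθ => by
    have hdist : dist (w + θ • v) w < δ := by
      rw [dist_eq_norm, add_sub_cancel_left, norm_smul, Real.norm_of_nonneg hθ.1]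
      refine (mul_le_of_le_one_left (norm_nonneg _) hθ.2.le).trans_lt ?_
      rwa [hv, ← dist_eq_norm]
    have h2 := hd hdist
    rw [dist_eq_norm] at h2
    rw [← BoundedContinuousFunction.sub_apply, ← _root_.sub_apply]
    refine (norm_coe_le_norm _ t).trans ((ContinuousLinearMap.le_opNorm _ _).trans ?_)
    gcongr
  have := norm_image_sub_le_of_norm_deriv_le_segment_01' hder hbound
  simp only [one_smul, zero_smul, add_zero, sub_zero] at this
  rw [show w + v = w' by simp [hv]] at this
  refine le_trans (le_of_eq ?_) this
  simp only [BoundedContinuousFunction.sub_apply]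
  congr 1
  abel

theorem contDiff_picard [CompleteSpace E] (t₀ : ℝ) : ContDiff ℝ 1 (B.picard t₀) :=
  contDiff_one_iff_hasFDerivAt.2
    ⟨B.picardDeriv t₀, B.continuous_picardDeriv t₀, B.hasFDerivAt_picard t₀⟩

/-- A perturbation of the identity by a contraction with constant `1/2`: the map `w ↦ w - picard w`,
whose inverse solves the integral equation. -/
theorem approximatesLinearOn_id_sub_picard (t₀ : ℝ) :
    ApproximatesLinearOn (fun w => w - B.picard t₀ w)
      (ContinuousLinearEquiv.refl ℝ (Curve E) : Curve E →L[ℝ] Curve E) univ (1 / 2) := by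
  intro w _ w' _
  have := B.norm_picard_sub_le t₀ w' w
  rw [norm_sub_rev w' w] at this
  change ‖w - B.picard t₀ w - (w' - B.picard t₀ w') - (w - w')‖ ≤ ((1 / 2 : ℝ≥0) : ℝ) * ‖w - w'‖
  rw [show w - B.picard t₀ w - (w' - B.picard t₀ w') - (w - w')
    = B.picard t₀ w' - B.picard t₀ w by abel]
  simpa using this

/-- The weighted constant curve `weight • x`. -/
def weightedConst (t₀ : ℝ) : E →L[ℝ] Curve E :=
  have bound : ∀ (x : E) (t : ℝ), ‖B.weight t₀ t • x‖ ≤ 1 * ‖x‖ := fun x t => by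
    rw [norm_smul, Real.norm_of_nonneg (B.weight_pos _ _).le]
    exact mul_le_mul_of_nonneg_right (B.weight_le_one _ _) (norm_nonneg _)
  LinearMap.mkContinuous
    { toFun := fun x => ofNormedAddCommGroup (fun t => B.weight t₀ t • x)
        ((B.continuous_weight t₀).smul continuous_const) (1 * ‖x‖) (bound x)
      map_add' := fun x y => by ext t; exact smul_add _ _ _
      map_smul' := fun c x => by ext t; exact smul_comm _ _ _ }
    1 fun x => (norm_le (by positivity)).2 (bound x)

theorem weightedConst_apply (t₀ : ℝ) (x : E) (t : ℝ) :
    B.weightedConst t₀ x t = B.weight t₀ t • x := rfl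

variable [CompleteSpace E]

/-! ### The flow -/

/-- The homeomorphism `w ↦ w - picard w` of the space of bounded continuous curves. -/
def solveHomeomorph (t₀ : ℝ) : Curve E ≃ₜ Curve E :=
  (B.approximatesLinearOn_id_sub_picard t₀).toHomeomorph _ (by
    rcases subsingleton_or_nontrivial (Curve E) with h | h
    · exact Or.inl h
    · right
      have : ‖((ContinuousLinearEquiv.refl ℝ (Curve E)).symm : Curve E →L[ℝ] Curve E)‖₊ = 1 := by
        simp
      rw [this, inv_one]
      exact NNReal.half_lt_self one_ne_zero)

theorem solveHomeomorph_apply (t₀ : ℝ) (w : Curve E) :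
    B.solveHomeomorph t₀ w = w - B.picard t₀ w := rfl

theorem contDiff_solveHomeomorph_symm (t₀ : ℝ) : ContDiff ℝ 1 (B.solveHomeomorph t₀).symm := by
  have hlt : ∀ w, ‖B.picardDeriv t₀ w‖ < 1 := fun w =>
    (B.norm_picardDeriv_le t₀ w).trans_lt (by norm_num)
  refine (B.solveHomeomorph t₀).contDiff_symm
    (f₀' := fun w => ContinuousLinearEquiv.unitsEquiv ℝ (Curve E) (Units.oneSub _ (hlt w)))
    (fun w => ?_) (contDiff_id.sub (B.contDiff_picard t₀))
  exact (hasFDerivAt_id w).sub (B.hasFDerivAt_picard t₀ w)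

theorem norm_solveHomeomorph_symm_sub_le (t₀ : ℝ) (z z' : Curve E) :
    ‖(B.solveHomeomorph t₀).symm z - (B.solveHomeomorph t₀).symm z'‖ ≤ 2 * ‖z - z'‖ := by
  obtain ⟨w, rfl⟩ := (B.solveHomeomorph t₀).surjective z
  obtain ⟨w', rfl⟩ := (B.solveHomeomorph t₀).surjective z'
  rw [Homeomorph.symm_apply_apply, Homeomorph.symm_apply_apply, solveHomeomorph_apply,
    solveHomeomorph_apply]
  have h1 := B.norm_picard_sub_le t₀ w w'
  have h2 : ‖w - w'‖ ≤ ‖w - B.picard t₀ w - (w' - B.picard t₀ w')‖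
      + ‖B.picard t₀ w - B.picard t₀ w'‖ := by
    refine le_trans (le_of_eq ?_) (norm_add_le _ _)
    congr 1
    abel
  linarith

/-- The flow of the field: `flow t₀ t x` is the position at time `t` of the particle that is at `x`
at time `t₀`. -/
def flow (t₀ t : ℝ) (x : E) : E :=
  B.unweight t₀ ((B.solveHomeomorph t₀).symm (B.weightedConst t₀ x)) t

theorem continuous_flow (t₀ : ℝ) (x : E) : Continuous fun t => B.flow t₀ t x :=
  B.continuous_unweight t₀ _

theorem flow_eq_integral (t₀ t : ℝ) (x : E) :
    B.flow t₀ t x = x + ∫ s in t₀..t, B.val s (B.flow t₀ s x) := by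
  set w := (B.solveHomeomorph t₀).symm (B.weightedConst t₀ x) with hw
  have h1 : w - B.picard t₀ w = B.weightedConst t₀ x := by
    rw [← solveHomeomorph_apply, hw, Homeomorph.apply_symm_apply]
  have h2 : w t = B.weight t₀ t • x
      + B.weight t₀ t • ∫ s in t₀..t, B.val s (B.unweight t₀ w s) := by
    rw [← picard_apply, ← weightedConst_apply, ← h1]
    simp
  change B.weightInv t₀ t • w t = x + ∫ s in t₀..t, B.val s (B.unweight t₀ w s)
  rw [h2, ← smul_add, smul_smul, weightInv_mul_weight, one_smul]

/-- Continuous solutions of the integral equation are given by the flow. -/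
theorem eq_flow {t₀ : ℝ} {x : E} {u : ℝ → E} (hu : Continuous u)
    (h : ∀ t, u t = x + ∫ s in t₀..t, B.val s (u s)) (t : ℝ) : u t = B.flow t₀ t x := by
  have hbound : ∀ t, ‖B.weight t₀ t • u t‖ ≤ ‖x‖ + ∫ s, ‖B.val s‖ := fun t => by
    rw [norm_smul, Real.norm_of_nonneg (B.weight_pos _ _).le, h t]
    refine (mul_le_of_le_one_left (norm_nonneg _) (B.weight_le_one _ _)).trans ?_
    refine (norm_add_le _ _).trans (add_le_add le_rfl ?_)
    refine intervalIntegral.norm_integral_le_integral_norm_uIoc.trans ?_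
    have hi := (B.integrable_val_comp hu).norm
    refine (setIntegral_le_integral hi (Eventually.of_forall fun s => norm_nonneg _)).trans ?_
    exact integral_mono hi B.integrable_val.norm fun s => (B.val s).norm_coe_le_norm _
  let w : Curve E := ofNormedAddCommGroup (fun t => B.weight t₀ t • u t)
    ((B.continuous_weight t₀).smul hu) _ hbound
  have hwu : B.unweight t₀ w = u := by
    funext s
    change B.weightInv t₀ s • B.weight t₀ s • u s = u s
    rw [smul_smul, weightInv_mul_weight, one_smul]
  have hw : B.solveHomeomorph t₀ w = B.weightedConst t₀ x := by
    ext s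
    rw [solveHomeomorph_apply, BoundedContinuousFunction.sub_apply, picard_apply, hwu,
      weightedConst_apply]
    change B.weight t₀ s • u s - _ = _
    rw [h s, ← smul_sub, ← h s, sub_eq_iff_eq_add.2 (h s)]
  rw [flow, ← hw, Homeomorph.symm_apply_apply, hwu]

theorem contDiff_flow (t₀ t : ℝ) : ContDiff ℝ 1 (B.flow t₀ t) :=
  ((evalCLM ℝ t).contDiff.comp ((B.contDiff_solveHomeomorph_symm t₀).comp
    (B.weightedConst t₀).contDiff)).const_smul (B.weightInv t₀ t)

theorem exists_lipschitzWith_flow (t₀ t : ℝ) : ∃ K, LipschitzWith K (B.flow t₀ t) := by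
  refine ⟨Real.toNNReal (B.weightInv t₀ t * (2 * ‖B.weightedConst t₀‖)),
    LipschitzWith.of_dist_le_mul fun x y => ?_⟩
  have hw := B.weightInv_pos t₀ t
  rw [Real.coe_toNNReal _ (by positivity), dist_eq_norm, dist_eq_norm, flow, flow, ← unweight_sub]
  refine (B.norm_unweight_le _ _ _).trans ?_
  rw [mul_assoc, mul_assoc]
  gcongr
  refine (B.norm_solveHomeomorph_symm_sub_le t₀ _ _).trans ?_
  gcongr
  rw [← map_sub]
  exact ContinuousLinearMap.le_opNorm _ _

theorem flow_self (t₀ : ℝ) (x : E) : B.flow t₀ t₀ x = x := by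
  rw [flow_eq_integral, intervalIntegral.integral_same, add_zero]

theorem flow_flow (t₀ t₁ t : ℝ) (x : E) : B.flow t₁ t (B.flow t₀ t₁ x) = B.flow t₀ t x := by
  refine (B.eq_flow (B.continuous_flow t₀ x) (fun r => ?_) t).symm
  have hi := B.integrable_val_comp (B.continuous_flow t₀ x)
  rw [B.flow_eq_integral t₀ r, B.flow_eq_integral t₀ t₁, add_assoc,
    intervalIntegral.integral_add_adjacent_intervals hi.intervalIntegrable hi.intervalIntegrable]

theorem flow_flow_cancel (t₀ t : ℝ) (x : E) : B.flow t t₀ (B.flow t₀ t x) = x := by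
  rw [flow_flow, flow_self]

/-- A point where the field vanishes at all times is at rest. -/
theorem flow_eq_self {x : E} (hx : ∀ s, B.val s x = 0) (t₀ t : ℝ) : B.flow t₀ t x = x :=
  (B.eq_flow continuous_const (fun r => by simp [hx]) t).symm

/-- If the field vanishes outside `Ω`, its flow does not leave `Ω`, since points outside `Ω` are at
rest and trajectories can be followed backwards. -/
theorem mapsTo_flow {Ω : Set E} (hΩ : ∀ s, ∀ x ∉ Ω, B.val s x = 0) (t₀ t : ℝ) :
    MapsTo (B.flow t₀ t) Ω Ω := by
  intro x hx
  by_contra h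
  have h1 := B.flow_flow_cancel t₀ t x
  rw [B.flow_eq_self (fun s => hΩ s _ h)] at h1
  rw [h1] at h
  exact h hx

end C1Field

/-! ### The embedding of `H³₀` into the bounded `C¹` fields -/

section TestFunctions

variable {F : Type*} [NormedAddCommGroup F] [NormedSpace ℝ F]

theorem enorm_le_lintegral_line {φ : Plane → F} (hφ : ContDiff ℝ 1 φ) (hc : HasCompactSupport φ)
    (p : Plane) (i : Fin 2) (r : ℝ) :
    ‖φ (p + r • EuclideanSpace.single i 1)‖ₑ
      ≤ ∫⁻ s : ℝ, ‖pderiv i φ (p + s • EuclideanSpace.single i 1)‖ₑ := by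
  set e : Plane := EuclideanSpace.single i 1 with he
  have hiso : Isometry fun s : ℝ => p + s • e := Isometry.of_dist_eq fun s s' => by
    rw [dist_add_left, dist_eq_norm, ← sub_smul, norm_smul, he, PiLp.norm_single,
      norm_one, mul_one, dist_eq_norm]
  have hd : ∀ s, HasDerivAt (fun s : ℝ => φ (p + s • e)) (pderiv i φ (p + s • e)) s := fun s => by
    refine ((hφ.differentiable one_ne_zero) _).hasFDerivAt.comp_hasDerivAt s ?_
    simpa using ((hasDerivAt_id s).smul_const e).const_add p
  have h1 := HasCompactSupport.enorm_le_lintegral_Ici_deriv (f := fun s : ℝ => φ (p + s • e))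
    (hφ.comp (by fun_prop)) (hc.comp_isClosedEmbedding hiso.isClosedEmbedding) r
  refine h1.trans ((setLIntegral_le_lintegral _ _).trans (le_of_eq ?_))
  exact lintegral_congr fun s => by rw [(hd s).deriv]

theorem measurePreserving_plane :
    MeasurePreserving (fun p : ℝ × ℝ => (!₂[p.1, p.2] : Plane)) := by
  have h1 := (EuclideanSpace.volume_preserving_symm_measurableEquiv_toLp (Fin 2)).symm
  have h2 := (volume_preserving_finTwoArrow ℝ).symm
  exact h1.comp h2

theorem plane_eq (a b : ℝ) : (!₂[a, b] : Plane)
    = a • EuclideanSpace.single 0 1 + b • EuclideanSpace.single 1 1 := by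
  ext i; fin_cases i <;> simp

/-- In the plane, the sup norm of a test function is controlled by the `L¹` norm of its mixed
second derivative: integrate along one axis, then along the other. -/
theorem enorm_le_lintegral_mixed {Ω : Set Plane} {φ : Plane → F} (hφ : IsTestFunction Ω φ)
    (x : Plane) : ‖φ x‖ₑ ≤ ∫⁻ y, ‖pderiv 0 (pderiv 1 φ) y‖ₑ := by
  have h1 := hφ.pderiv 1
  have hm : Measurable fun y => ‖pderiv 0 (pderiv 1 φ) y‖ₑ :=
    (h1.pderiv 0).smooth.continuous.enorm.measurable
  have hx : x = x 0 • EuclideanSpace.single 0 1 + x 1 • EuclideanSpace.single 1 1 := by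
    rw [← plane_eq]; ext i; fin_cases i <;> rfl
  rw [← measurePreserving_plane.lintegral_comp hm]
  rw [Measure.volume_eq_prod, lintegral_prod_symm'
    (fun p : ℝ × ℝ => ‖pderiv 0 (pderiv 1 φ) !₂[p.1, p.2]‖ₑ)
    (hm.comp measurePreserving_plane.measurable)]
  conv_lhs => rw [hx]
  refine (enorm_le_lintegral_line (hφ.smooth.of_le (by simp)) hφ.compact _ 1 _).trans ?_
  refine lintegral_mono fun r => ?_
  simp only [plane_eq]
  rw [add_comm]
  refine (enorm_le_lintegral_line (h1.smooth.of_le (by simp)) h1.compact _ 0 _).trans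
    (le_of_eq ?_)
  exact lintegral_congr fun s => by rw [add_comm]

theorem IsTestFunction.eq_zero {Ω : Set Plane} {φ : Plane → F} (hφ : IsTestFunction Ω φ)
    {x : Plane} (hx : x ∉ Ω) : φ x = 0 :=
  image_eq_zero_of_notMem_tsupport fun h => hx (hφ.support h)

theorem IsTestFunction.pderiv_comm {Ω : Set Plane} {φ : Plane → F} (hφ : IsTestFunction Ω φ) :
    ClassicalFlow.pderiv 1 (ClassicalFlow.pderiv 0 φ)
      = ClassicalFlow.pderiv 0 (ClassicalFlow.pderiv 1 φ) := by
  funext x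
  have hd : DifferentiableAt ℝ (fderiv ℝ φ) x :=
    ((hφ.smooth.fderiv_right (m := ∞) le_rfl).differentiable (by simp)) x
  have h : ∀ v w : Plane, fderiv ℝ (fun y => fderiv ℝ φ y v) x w = fderiv ℝ (fderiv ℝ φ) x w v :=
    fun v w => by
      rw [fderiv_clm_apply hd (differentiableAt_const v)]
      simp
  have hs : IsSymmSndFDerivAt ℝ φ x :=
    hφ.smooth.contDiffAt.isSymmSndFDerivAt (by
      simpa using WithTop.coe_le_coe.2 (le_top : (2 : ℕ∞) ≤ ⊤))
  exact (h _ _).trans ((hs _ _).trans (h _ _).symm)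

end TestFunctions

section Sobolev

variable {Ω : Set Plane}

/-- The multi-index `(1, 1)`. -/
def idx11 : MultiIndex := ⟨(1, 1), by decide⟩

/-- The multi-index `(1, 2)`. -/
def idx12 : MultiIndex := ⟨(1, 2), by decide⟩

/-- The multi-index `(2, 1)`. -/
def idx21 : MultiIndex := ⟨(2, 1), by decide⟩

/-- The square root of the area of `Ω`, the constant of the Cauchy-Schwarz inequality between
`L¹(Ω)` and `L²(Ω)`. -/
def sqrtArea (Ω : Set Plane) : ℝ := (volume Ω ^ (1 / 2 : ℝ)).toReal

theorem sqrtArea_nonneg (Ω : Set Plane) : 0 ≤ sqrtArea Ω := ENNReal.toReal_nonneg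

/-- The sup norm of a test function is controlled by the `L²(Ω)` norm of the class `g` of its mixed
second derivative. -/
theorem norm_le_of_mixed_ae_eq (hΩ : Bornology.IsBounded Ω) {ψ : Plane → Plane}
    (hψ : IsTestFunction Ω ψ) {g : L2 Ω}
    (hg : (g : Plane → Plane) =ᵐ[volume.restrict Ω] pderiv 0 (pderiv 1 ψ)) (x : Plane) :
    ‖ψ x‖ ≤ sqrtArea Ω * ‖g‖ := by
  have hfin : volume Ω ≠ ⊤ := hΩ.measure_lt_top.ne
  have hD := (hψ.pderiv 1).pderiv 0
  have h1 : ‖ψ x‖ₑ ≤ ‖g‖ₑ * volume Ω ^ (1 / 2 : ℝ) := by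
    refine (enorm_le_lintegral_mixed hψ x).trans ?_
    rw [← setLIntegral_eq_of_support_subset (s := Ω)
      (fun y hy => by_contra fun h => hy (by simp [hD.eq_zero h])), ← eLpNorm_one_eq_lintegral_enorm]
    refine (eLpNorm_le_eLpNorm_mul_rpow_measure_univ (p := 1) (q := 2) (by norm_num)
      hD.smooth.continuous.aestronglyMeasurable).trans (le_of_eq ?_)
    rw [Measure.restrict_apply_univ, ← eLpNorm_congr_ae hg, Lp.enorm_def]
    norm_num
  have h2 : ‖g‖ₑ * volume Ω ^ (1 / 2 : ℝ) ≠ ⊤ :=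
    ENNReal.mul_ne_top enorm_ne_top (ENNReal.rpow_ne_top_of_nonneg (by norm_num) hfin)
  have h3 := ENNReal.toReal_mono h2 h1
  rwa [ENNReal.toReal_mul, toReal_enorm, toReal_enorm, mul_comm] at h3

theorem norm_clm_plane_le (A : Plane →L[ℝ] Plane) {c : ℝ} (hc : 0 ≤ c)
    (h : ∀ i, ‖A (EuclideanSpace.single i 1)‖ ≤ c) : ‖A‖ ≤ 2 * c := by
  refine A.opNorm_le_bound (by positivity) fun v => ?_
  have hv : v = v 0 • EuclideanSpace.single 0 1 + v 1 • EuclideanSpace.single 1 1 := by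
    rw [← plane_eq]; ext i; fin_cases i <;> rfl
  have h0 := PiLp.norm_apply_le v 0
  have h1 := PiLp.norm_apply_le v 1
  calc ‖A v‖ ≤ ‖v 0‖ * ‖A (EuclideanSpace.single 0 1)‖
        + ‖v 1‖ * ‖A (EuclideanSpace.single 1 1)‖ := by
        conv_lhs => rw [hv, map_add, map_smul, map_smul]
        refine (norm_add_le _ _).trans ?_
        rw [norm_smul, norm_smul]
    _ ≤ ‖v‖ * c + ‖v‖ * c := by
        gcongr
        · exact h 0
        · exact h 1
    _ = 2 * c * ‖v‖ := by ring

/-- The pairs of bounded continuous maps `(f, f')` that are to be a field and its derivative. -/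
abbrev C1Pair : Type := (Plane →ᵇ Plane) × BddMap Plane (Plane →L[ℝ] Plane)

/-- The graph `{(jet of φ, (φ, Dφ))}` over the test functions. Its closure is the graph of the
embedding of `H³₀` into the bounded `C¹` fields. -/
def jetGraph (Ω : Set Plane) : Submodule ℝ (Jet Ω × C1Pair) where
  carrier := {z | ∃ φ : Plane → Plane, IsTestFunction Ω φ ∧
    (∀ α, (z.1 α : Plane → Plane) =ᵐ[volume.restrict Ω] mderiv α φ) ∧
    (∀ x, z.2.1 x = φ x) ∧ ∀ x, z.2.2 x = fderiv ℝ φ x}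
  zero_mem' := by
    refine ⟨0, IsTestFunction.zero Ω, fun α => ?_, fun x => rfl, fun x => ?_⟩
    · rw [mderiv_zero]; exact Lp.coeFn_zero _ _ _
    · simp
  add_mem' := by
    rintro z z' ⟨φ, hφ, h1, h2, h3⟩ ⟨ψ, hψ, k1, k2, k3⟩
    refine ⟨φ + ψ, hφ.add hψ, fun α => ?_, fun x => ?_, fun x => ?_⟩
    · rw [mderiv_add hφ hψ]
      exact (Lp.coeFn_add _ _).trans ((h1 α).add (k1 α))
    · simp [h2, k2]
    · rw [fderiv_add (hφ.smooth.differentiable (by simp) x) (hψ.smooth.differentiable (by simp) x)]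
      simp [h3, k3]
  smul_mem' := by
    rintro c z ⟨φ, hφ, h1, h2, h3⟩
    refine ⟨c • φ, hφ.const_smul c, fun α => ?_, fun x => ?_, fun x => ?_⟩
    · rw [mderiv_const_smul hφ]
      exact (Lp.coeFn_smul _ _).trans ((h1 α).const_smul c)
    · simp [h2]
    · rw [fderiv_const_smul (hφ.smooth.differentiable (by simp) x)]
      simp [h3]

/-- The Sobolev estimate `‖φ‖_{C¹} ≤ C ‖φ‖_{H³}` for test functions. The derivatives `∂₁φ` and `∂₂φ`
are estimated through the third derivatives `∂^(2,1) φ` and `∂^(1,2) φ`. -/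
theorem norm_snd_le_of_mem_jetGraph (hΩ : Bornology.IsBounded Ω) {z : Jet Ω × C1Pair}
    (hz : z ∈ jetGraph Ω) : ‖z.2‖ ≤ 2 * sqrtArea Ω * ‖z.1‖ := by
  obtain ⟨φ, hφ, h1, h2, h3⟩ := hz
  have hA := sqrtArea_nonneg Ω
  have hJ : ∀ α, sqrtArea Ω * ‖z.1 α‖ ≤ sqrtArea Ω * ‖z.1‖ := fun α =>
    mul_le_mul_of_nonneg_left (PiLp.norm_apply_le z.1 α) hA
  have hC : 0 ≤ sqrtArea Ω * ‖z.1‖ := by positivity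
  refine max_le ((norm_le (by positivity)).2 fun x => ?_)
    ((norm_le (by positivity)).2 fun x => ?_)
  · rw [h2]
    have := (norm_le_of_mixed_ae_eq hΩ hφ (h1 idx11) x).trans (hJ _)
    linarith
  · rw [h3, mul_assoc]
    refine norm_clm_plane_le _ hC fun i => ?_
    fin_cases i
    · refine (norm_le_of_mixed_ae_eq hΩ (hφ.pderiv 0) (g := z.1 idx21) ?_ x).trans (hJ _)
      rw [hφ.pderiv_comm]
      exact h1 idx21
    · exact (norm_le_of_mixed_ae_eq hΩ (hφ.pderiv 1) (h1 idx12) x).trans (hJ _)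

theorem norm_le_of_mem_closure (hΩ : Bornology.IsBounded Ω) {J : Jet Ω} {p : C1Pair}
    (hz : (J, p) ∈ (jetGraph Ω).topologicalClosure) : ‖p‖ ≤ 2 * sqrtArea Ω * ‖J‖ := by
  have hclosed : IsClosed {z : Jet Ω × C1Pair | ‖z.2‖ ≤ 2 * sqrtArea Ω * ‖z.1‖} :=
    isClosed_le continuous_snd.norm (continuous_fst.norm.const_mul _)
  have hsub : (jetGraph Ω : Set (Jet Ω × C1Pair)) ⊆ {z | ‖z.2‖ ≤ 2 * sqrtArea Ω * ‖z.1‖} :=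
    fun z h => norm_snd_le_of_mem_jetGraph hΩ h
  have h : (J, p) ∈ {z : Jet Ω × C1Pair | ‖z.2‖ ≤ 2 * sqrtArea Ω * ‖z.1‖} :=
    closure_minimal hsub hclosed hz
  simpa only [mem_ofPred_eq] using h

theorem exists_mem_jetGraph {J : Jet Ω} (hJ : J ∈ testJets Ω) :
    ∃ p : C1Pair, (J, p) ∈ jetGraph Ω := by
  obtain ⟨φ, hφ, h1⟩ := hJ
  have hc := hφ.smooth.continuous
  have hc' := hφ.smooth.continuous_fderiv (by simp)
  obtain ⟨C, hC⟩ := hc.bounded_above_of_compact_support hφ.compact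
  obtain ⟨C', hC'⟩ := hc'.bounded_above_of_compact_support (hφ.compact.fderiv (𝕜 := ℝ))
  exact ⟨(ofNormedAddCommGroup φ hc C hC, ofNormedAddCommGroup _ hc' C' hC'), φ, hφ, h1,
    fun _ => rfl, fun _ => rfl⟩

/-- The embedding is defined on all of `H³₀`: by the Sobolev estimate, the `C¹` data of a convergent
sequence of test jets form a Cauchy sequence. -/
theorem exists_mem_closure_jetGraph (hΩ : Bornology.IsBounded Ω) {J : Jet Ω}
    (hJ : J ∈ (testJets Ω).topologicalClosure) :
    ∃ p : C1Pair, (J, p) ∈ (jetGraph Ω).topologicalClosure := by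
  obtain ⟨j, hj, hlim⟩ := mem_closure_iff_seq_limit.1 hJ
  choose p hp using fun n => exists_mem_jetGraph (hj n)
  have hC := sqrtArea_nonneg Ω
  have hcauchy : CauchySeq p := by
    rw [Metric.cauchySeq_iff]
    intro ε hε
    obtain ⟨N, hN⟩ := Metric.cauchySeq_iff.1 hlim.cauchySeq (ε / (2 * sqrtArea Ω + 1))
      (by positivity)
    refine ⟨N, fun m hm n hn => ?_⟩
    have h1 := norm_snd_le_of_mem_jetGraph hΩ ((jetGraph Ω).sub_mem (hp m) (hp n))
    have h2 := hN m hm n hn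
    rw [lt_div_iff₀ (by positivity), dist_eq_norm] at h2
    rw [dist_eq_norm]
    refine h1.trans_lt (lt_of_le_of_lt ?_ h2)
    change 2 * sqrtArea Ω * ‖j m - j n‖ ≤ _
    nlinarith [norm_nonneg (j m - j n)]
  obtain ⟨q, hq⟩ := cauchySeq_tendsto_of_complete hcauchy
  exact ⟨q, mem_closure_iff_seq_limit.2 ⟨fun n => (j n, p n), hp, hlim.prodMk_nhds hq⟩⟩

theorem eq_zero_of_mem_closure {z : Jet Ω × C1Pair} (hz : z ∈ (jetGraph Ω).topologicalClosure)
    {x : Plane} (hx : x ∉ Ω) : z.2.1 x = 0 :=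
  closure_minimal (s := (jetGraph Ω : Set (Jet Ω × C1Pair))) (t := {z | z.2.1 x = 0})
    (fun _ ⟨_, hφ, _, h2, _⟩ => (h2 x).trans (hφ.eq_zero hx))
    (isClosed_eq ((ContinuousEvalConst.continuous_eval_const x).comp
      (continuous_fst.comp continuous_snd)) continuous_const) hz

theorem hasFDerivAt_of_mem_closure {z : Jet Ω × C1Pair}
    (hz : z ∈ (jetGraph Ω).topologicalClosure) (x : Plane) : HasFDerivAt z.2.1 (z.2.2 x) x := by
  obtain ⟨y, hy, hlim⟩ := mem_closure_iff_seq_limit.1 hz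
  have h1 : Tendsto (fun n => (y n).2.1) atTop (𝓝 z.2.1) :=
    ((continuous_fst.comp continuous_snd).tendsto z).comp hlim
  have h2 : Tendsto (fun n => (y n).2.2) atTop (𝓝 z.2.2) :=
    ((continuous_snd.comp continuous_snd).tendsto z).comp hlim
  refine hasFDerivAt_of_tendstoUniformly (f := fun n => (y n).2.1) (f' := fun n => (y n).2.2)
    (tendsto_iff_tendstoUniformly.1 h2) (fun n x => ?_)
    (fun x => ((tendsto_iff_tendstoUniformly.1 h1).tendsto_at x)) x
  obtain ⟨φ, hφ, _, h3, h4⟩ := hy n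
  rw [h4, show ⇑(y n).2.1 = φ from funext h3]
  exact (hφ.smooth.differentiable (by simp) x).hasFDerivAt

theorem ae_eq_of_mem_closure (hΩ : Bornology.IsBounded Ω) {z : Jet Ω × C1Pair}
    (hz : z ∈ (jetGraph Ω).topologicalClosure) :
    (z.2.1 : Plane → Plane) =ᵐ[volume.restrict Ω] z.1 idx00 := by
  have : IsFiniteMeasure (volume.restrict Ω) :=
    isFiniteMeasure_restrict.2 hΩ.measure_lt_top.ne
  have h : toLp (E := Plane) 2 (volume.restrict Ω) ℝ z.2.1 = z.1 idx00 :=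
    closure_minimal (s := (jetGraph Ω : Set (Jet Ω × C1Pair)))
      (t := {z | toLp (E := Plane) 2 (volume.restrict Ω) ℝ z.2.1 = z.1 idx00})
      (fun z' ⟨φ, hφ, h1, h2, _⟩ => by
        refine Lp.ext ((coeFn_toLp _ _ _ _).trans ?_)
        rw [show ⇑z'.2.1 = φ from funext h2]
        exact (h1 idx00).symm)
      (isClosed_eq (by fun_prop) (by fun_prop)) hz
  rw [← h]
  exact (coeFn_toLp _ _ _ _).symm

/-- The bounded `C¹` extension to the plane, with its derivative, of a field in
`H^{3,div}_0(Ω)²`. -/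
def c1Ext (hΩ : Bornology.IsBounded Ω) (J : H30div Ω) : C1Pair :=
  (exists_mem_closure_jetGraph hΩ J.2.1.2).choose

theorem mem_closure_c1Ext (hΩ : Bornology.IsBounded Ω) (J : H30div Ω) :
    ((J : Jet Ω), c1Ext hΩ J) ∈ (jetGraph Ω).topologicalClosure :=
  (exists_mem_closure_jetGraph hΩ J.2.1.2).choose_spec

theorem norm_c1Ext_le (hΩ : Bornology.IsBounded Ω) (J : H30div Ω) :
    ‖c1Ext hΩ J‖ ≤ 2 * sqrtArea Ω * ‖J‖ :=
  norm_le_of_mem_closure hΩ (mem_closure_c1Ext hΩ J)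

theorem continuous_c1Ext (hΩ : Bornology.IsBounded Ω) : Continuous (c1Ext hΩ) := by
  refine LipschitzWith.continuous (K := Real.toNNReal (2 * sqrtArea Ω))
    (LipschitzWith.of_dist_le_mul fun J J' => ?_)
  rw [Real.coe_toNNReal _ (by have := sqrtArea_nonneg Ω; positivity), dist_eq_norm, dist_eq_norm]
  have h := (jetGraph Ω).topologicalClosure.sub_mem
    (mem_closure_c1Ext hΩ J) (mem_closure_c1Ext hΩ J')
  rw [Prod.mk_sub_mk] at h
  exact norm_le_of_mem_closure hΩ h

/-- Two continuous functions that agree almost everywhere on the open set `Ω` agree on `Ω`, so the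
chosen continuous representative is the restriction of the extension. -/
theorem contRep_eq_c1Ext (hΩ : Bornology.IsBounded Ω) (hO : IsOpen Ω) (J : H30div Ω)
    {x : Plane} (hx : x ∈ Ω) : contRep Ω ((J : Jet Ω) idx00) x = (c1Ext hΩ J).1 x := by
  have hae := ae_eq_of_mem_closure hΩ (mem_closure_c1Ext hΩ J)
  have h : ∃ g : Plane → Plane, ContinuousOn g Ω ∧
      g =ᵐ[volume.restrict Ω] ((J : Jet Ω) idx00 : Plane → Plane) :=
    ⟨_, (c1Ext hΩ J).1.continuous.continuousOn, hae⟩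
  rw [contRep, dif_pos h]
  exact Measure.eqOn_open_of_ae_eq (h.choose_spec.2.trans hae.symm) hO h.choose_spec.1
    (c1Ext hΩ J).1.continuous.continuousOn hx

end Sobolev

/-! ### Classical flows of the given field -/

/-- Absolute continuity of vector valued primitives, by comparison with the primitive of the
norm. -/
theorem absolutelyContinuousOnInterval_primitive {E : Type*} [NormedAddCommGroup E]
    [NormedSpace ℝ E] {f : ℝ → E} (hf : Integrable f) (x : E) (t₀ : ℝ) {a c : ℝ}
    (ha : t₀ ∈ uIcc a c) :
    AbsolutelyContinuousOnInterval (fun t => x + ∫ s in t₀..t, f s) a c := by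
  have h := (hf.norm.intervalIntegrable
    (a := a) (b := c)).absolutelyContinuousOnInterval_intervalIntegral ha
  refine squeeze_zero (fun I => Finset.sum_nonneg fun i _ => dist_nonneg) (fun I => ?_) h
  refine Finset.sum_le_sum fun i _ => ?_
  rw [dist_add_left, dist_eq_norm, Real.dist_eq,
    intervalIntegral.integral_interval_sub_left hf.intervalIntegrable hf.intervalIntegrable,
    intervalIntegral.integral_interval_sub_left hf.norm.intervalIntegrable
      hf.norm.intervalIntegrable]
  exact intervalIntegral.norm_integral_le_abs_integral_norm

section Field

variable {T : ℝ} {Ω : Set Plane}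

/-- A flow field, extended by zero to the whole plane and to all times. -/
def extField (hΩ : Bornology.IsBounded Ω) (b : FlowField T Ω) : C1Field Plane :=
  have hint : IntegrableOn (fun t => c1Ext hΩ (b t)) (Icc 0 T) := by
    have hb : Integrable b (volume.restrict (Icc 0 T)) := (Lp.memLp b).integrable (by norm_num)
    exact (hb.norm.const_mul (2 * sqrtArea Ω)).mono'
      ((continuous_c1Ext hΩ).comp_aestronglyMeasurable hb.aestronglyMeasurable)
      (Eventually.of_forall fun t => norm_c1Ext_le hΩ (b t))
  { val := (Icc 0 T).indicator fun t => (c1Ext hΩ (b t)).1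
    der := (Icc 0 T).indicator fun t => (c1Ext hΩ (b t)).2
    hasFDerivAt := fun t x => by
      by_cases ht : t ∈ Icc 0 T
      · rw [indicator_of_mem ht, indicator_of_mem ht]
        exact hasFDerivAt_of_mem_closure (mem_closure_c1Ext hΩ (b t)) x
      · rw [indicator_of_notMem ht, indicator_of_notMem ht]
        exact hasFDerivAt_const 0 x
    integrable_val := (integrable_indicator_iff measurableSet_Icc).2 hint.fst
    integrable_der := (integrable_indicator_iff measurableSet_Icc).2 hint.snd }

theorem extField_val_eq_eval (hΩ : Bornology.IsBounded Ω) (hO : IsOpen Ω) (b : FlowField T Ω)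
    {t : ℝ} (ht : t ∈ Icc 0 T) {x : Plane} (hx : x ∈ Ω) :
    (extField hΩ b).val t x = b.eval t x := by
  rw [FlowField.eval, contRep_eq_c1Ext hΩ hO (b t) hx]
  change (Icc 0 T).indicator (fun t => (c1Ext hΩ (b t)).1) t x = _
  rw [indicator_of_mem ht]

theorem extField_val_of_notMem (hΩ : Bornology.IsBounded Ω) (b : FlowField T Ω) (t : ℝ)
    {x : Plane} (hx : x ∉ Ω) : (extField hΩ b).val t x = 0 := by
  change (Icc 0 T).indicator (fun t => (c1Ext hΩ (b t)).1) t x = _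
  by_cases ht : t ∈ Icc 0 T
  · rw [indicator_of_mem ht]
    exact eq_zero_of_mem_closure (mem_closure_c1Ext hΩ (b t)) hx
  · rw [indicator_of_notMem ht]
    rfl

theorem extField_val_of_notMem_Icc (hΩ : Bornology.IsBounded Ω) (b : FlowField T Ω) {t : ℝ}
    (ht : t ∉ Icc 0 T) : (extField hΩ b).val t = 0 :=
  indicator_of_notMem ht fun t => (c1Ext hΩ (b t)).1

theorem isClassicalFlow_flow (hΩ : Bornology.IsBounded Ω) (hO : IsOpen Ω)
    (b : FlowField T Ω) : IsClassicalFlow b ((extField hΩ b).flow 0) where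
  mapsTo := fun t _ => (extField hΩ b).mapsTo_flow
    (fun s _ hx => extField_val_of_notMem hΩ b s hx) 0 t
  initial := fun x _ => (extField hΩ b).flow_self 0 x
  absCont := fun x _ => by
    have hi := (extField hΩ b).integrable_val_comp ((extField hΩ b).continuous_flow 0 x)
    have h := absolutelyContinuousOnInterval_primitive hi x 0 (a := 0) (c := T) left_mem_uIcc
    simpa only [← C1Field.flow_eq_integral] using h
  ode := fun x hx => by
    have hi := (extField hΩ b).integrable_val_comp ((extField hΩ b).continuous_flow 0 x)
    have h := LocallyIntegrable.ae_hasDerivAt_integral hi.locallyIntegrable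
    filter_upwards [ae_restrict_of_ae h, ae_restrict_mem measurableSet_Icc] with t ht htT
    have hm : (extField hΩ b).flow 0 t x ∈ Ω := (extField hΩ b).mapsTo_flow
      (fun s _ hx => extField_val_of_notMem hΩ b s hx) 0 t hx
    have h1 := (ht 0).const_add x
    rw [extField_val_eq_eval hΩ hO b htT hm] at h1
    simpa only [← C1Field.flow_eq_integral] using h1

/-- Uniqueness: the trajectories of a classical flow solve the integral equation of the extended
field. -/
theorem IsClassicalFlow.eqOn_flow (hT : 0 < T) (hΩ : Bornology.IsBounded Ω) (hO : IsOpen Ω)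
    {b : FlowField T Ω} {Φ : ℝ → Plane → Plane} (hΦ : IsClassicalFlow b Φ) {t : ℝ}
    (ht : t ∈ Icc 0 T) : EqOn (Φ t) ((extField hΩ b).flow 0 t) Ω := by
  intro x hx
  set B := extField hΩ b with hB
  have hac := hΦ.absCont x hx
  have hcont : ContinuousOn (fun s => Φ s x) (Icc 0 T) := by
    simpa only [uIcc_of_le hT.le] using hac.continuousOn
  -- The trajectory, frozen before time `0` and after time `T`.
  let c : ℝ → Plane := IccExtend hT.le (domRestrict (Icc 0 T) fun s => Φ s x)
  have hc : Continuous c := (continuousOn_iff_continuous_domRestrict.1 hcont).Icc_extend'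
  have hcΦ : ∀ s ∈ Icc 0 T, c s = Φ s x := fun s hs => IccExtend_of_mem hT.le _ hs
  have hi := B.integrable_val_comp hc
  let u : ℝ → Plane := fun r => x + ∫ s in (0 : ℝ)..r, B.val s (c s)
  have hu : Continuous u := continuous_const.add (hi.continuous_primitive 0)
  -- `Φ · x - u` is absolutely continuous with vanishing derivative.
  have hsub : AbsolutelyContinuousOnInterval (fun s => Φ s x - u s) 0 T :=
    hac.fun_sub (absolutelyContinuousOnInterval_primitive hi x 0 left_mem_uIcc)
  have hderiv : ∀ᵐ s, s ∈ uIcc 0 T → HasDerivAt (fun s => Φ s x - u s) 0 s := by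
    rw [uIcc_of_le hT.le]
    filter_upwards [(ae_restrict_iff' measurableSet_Icc).1 (hΦ.ode x hx),
      LocallyIntegrable.ae_hasDerivAt_integral hi.locallyIntegrable] with s h1 h2 hs
    have h3 := (h1 hs).sub ((h2 0).const_add x)
    rwa [hcΦ s hs, hB, extField_val_eq_eval hΩ hO b hs (hΦ.mapsTo s hs hx), sub_self] at h3
  obtain ⟨C, hC⟩ := hsub.const_of_ae_hasDerivAt_zero hderiv
  rw [uIcc_of_le hT.le] at hC
  have hC0 : C = 0 := by
    rw [← hC 0 (left_mem_Icc.2 hT.le)]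
    simp [u, hΦ.initial x hx]
  have hΦu : ∀ s ∈ Icc 0 T, Φ s x = u s := fun s hs => by
    rw [← sub_eq_zero, hC s hs, hC0]
  -- Outside `[0, T]` the field vanishes, so `u` solves the integral equation for all times.
  have hval : ∀ s, B.val s (c s) = B.val s (u s) := fun s => by
    by_cases hs : s ∈ Icc 0 T
    · rw [hcΦ s hs, hΦu s hs]
    · rw [hB, extField_val_of_notMem_Icc hΩ b hs]
      rfl
  rw [hΦu t ht]
  exact B.eq_flow hu (fun r => by simp only [u, ← hval]) t

theorem isC1DiffeoOn_flow (hΩ : Bornology.IsBounded Ω) (b : FlowField T Ω) (t : ℝ) :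
    IsC1DiffeoOn Ω ((extField hΩ b).flow 0 t) := by
  set B := extField hΩ b
  have hmaps : ∀ t₀ t, MapsTo (B.flow t₀ t) Ω Ω :=
    B.mapsTo_flow fun s _ hx => extField_val_of_notMem hΩ b s hx
  have hinv : InvOn (B.flow t 0) (B.flow 0 t) Ω Ω :=
    ⟨fun x _ => B.flow_flow_cancel 0 t x, fun x _ => B.flow_flow_cancel t 0 x⟩
  exact ⟨hinv.bijOn (hmaps 0 t) (hmaps t 0), (B.contDiff_flow 0 t).contDiffOn, B.flow t 0,
    hmaps t 0, hinv, (B.contDiff_flow t 0).contDiffOn⟩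

theorem IsC1DiffeoOn.congr {f f' : Plane → Plane} (hf : IsC1DiffeoOn Ω f) (h : EqOn f' f Ω) :
    IsC1DiffeoOn Ω f' := by
  obtain ⟨hbij, hC, g, hg, hinv, hgC⟩ := hf
  refine ⟨hbij.congr h.symm, hC.congr h, g, hg, ⟨fun x hx => ?_, fun y hy => ?_⟩, hgC⟩
  · rw [h hx]; exact hinv.1 hx
  · rw [h (hg hy)]; exact hinv.2 hy

end Field

end ClassicalFlow

end

theorem mainTheorem5 (T : ℝ) (hT : 0 < T) (Ω : Set ClassicalFlow.Plane)
    (hΩ_open : IsOpen Ω) (hΩ_convex : Convex ℝ Ω) (hΩ_bdd : Bornology.IsBounded Ω)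
    (b : ClassicalFlow.FlowField T Ω) :
    (∃ Φ : ℝ → ClassicalFlow.Plane → ClassicalFlow.Plane,
      ClassicalFlow.IsClassicalFlow b Φ) ∧
    (∀ Φ Ψ : ℝ → ClassicalFlow.Plane → ClassicalFlow.Plane,
      ClassicalFlow.IsClassicalFlow b Φ → ClassicalFlow.IsClassicalFlow b Ψ →
        ∀ t ∈ Set.Icc 0 T, Set.EqOn (Φ t) (Ψ t) Ω) ∧
    (∀ Φ : ℝ → ClassicalFlow.Plane → ClassicalFlow.Plane,
      ClassicalFlow.IsClassicalFlow b Φ → ∀ t ∈ Set.Icc 0 T,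
        (∃ K : ℝ≥0, LipschitzOnWith K (Φ t) Ω) ∧ ClassicalFlow.IsC1DiffeoOn Ω (Φ t)) := by
  refine ⟨⟨_, ClassicalFlow.isClassicalFlow_flow hΩ_bdd hΩ_open b⟩, fun Φ Ψ hΦ hΨ t ht => ?_,
    fun Φ hΦ t ht => ?_⟩
  · exact (hΦ.eqOn_flow hT hΩ_bdd hΩ_open ht).trans (hΨ.eqOn_flow hT hΩ_bdd hΩ_open ht).symm
  · have h := hΦ.eqOn_flow hT hΩ_bdd hΩ_open ht
    obtain ⟨K, hK⟩ := (ClassicalFlow.extField hΩ_bdd b).exists_lipschitzWith_flow 0 t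
    refine ⟨⟨K, fun x hx y hy => ?_⟩, (ClassicalFlow.isC1DiffeoOn_flow hΩ_bdd b t).congr h⟩
    rw [h hx, h hy]
    exact hK x y
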